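/- Let $A\in\mathbb{R}^{d\times d}$ be Hurwitz (all eigenvalues have strictly negative real part), let $b\in\mathbb{R}^d$, and let $x^*$ be the unique solution of $Ax+b=0$. Let $(w_k)_{k\ge 0}$ be i.i.d. random vectors in $\mathbb{R}^d$ with mean zero and positive definite covariance matrix $\Sigma$. For a stepsize $\alpha>0$ and an initialization $X_0^{(\alpha)}$ (deterministic or random), let $$X_{k+1}^{(\alpha)}=X_k^{(\alpha)}+\alpha\bigl(AX_k^{(\alpha)}+b+w_k\bigr),\qquad Y_k^{(\alpha)}=\frac{X_k^{(\alpha)}-x^*}{\sqrt{\alpha}},$$ so that $Y_{k+1}^{(\alpha)}=(I+\alpha A)Y_k^{(\alpha)}+\sqrt{\alpha}\,w_k$. Then there exists a threshold $\bar\alpha>0$, independent of the initialization, such that the following hold. (1) For every $\alpha\in(0,\bar\alpha)$, as $k\to\infty$ the sequence $Y_k^{(\alpha)}$ converges weakly to a random vector $Y^{(\alpha)}$ whose law does not depend on the initialization; this law is stationary for the recursion of $Y_k^{(\alpha)}$, and $\mathbb{E}\bigl[\|Y^{(\alpha)}\|_2^2\bigr]<\infty$. (2) There is a random vector $Y$ such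 that for every sequence $(\alpha_i)$ in $(0,\bar\alpha)$ with $\alpha_i\to0$ the sequence $Y^{(\alpha_i)}$ converges weakly to $Y$, and $$\mathbb{E}\Bigl[\bigl(t^\top\Sigma t-2i\,t^\top AY\bigr)e^{i t^\top Y}\Bigr]=0\qquad\text{for all } t\in\mathbb{R}^d,$$ where the expectation exists. If, in addition, this equation has a unique solution in terms of the distribution of $Y$ (among the probability laws on $\mathbb{R}^d$ for which the expectations exist), then $Y$ is multivariate normal with mean zero and covariance matrix $\Sigma_Y$, where $\Sigma_Y$ is the unique solution of the Lyapunov equation $A\Sigma_Y+\Sigma_YA^\top+\Sigma=0$, and $\Sigma_Y$ is positive definite. -/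

import Mathlib

open MeasureTheory ProbabilityTheory Filter Topology Matrix

noncomputable section

/-- A real square matrix is Hurwitz if all its (complex) eigenvalues have strictly negative
real part. -/
def IsHurwitz {d : ℕ} (A : Matrix (Fin d) (Fin d) ℝ) : Prop :=
  ∀ z ∈ spectrum ℂ (A.map (algebraMap ℝ ℂ)), z.re < 0

/-- The matrix-vector product `A x` on Euclidean space. -/
def matVec {d : ℕ} (A : Matrix (Fin d) (Fin d) ℝ) (x : EuclideanSpace ℝ (Fin d)) :
    EuclideanSpace ℝ (Fin d) :=
  WithLp.toLp 2 (A *ᵥ x.ofLp)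

/-- The iterates of linear stochastic approximation with constant stepsize `α`:
`X (k+1) = X k + α (A (X k) + b + w k)`, started at `X₀`. -/
def linearSA {Ω : Type*} {d : ℕ} (A : Matrix (Fin d) (Fin d) ℝ) (b : EuclideanSpace ℝ (Fin d))
    (w : ℕ → Ω → EuclideanSpace ℝ (Fin d)) (α : ℝ) (X₀ : Ω → EuclideanSpace ℝ (Fin d)) :
    ℕ → Ω → EuclideanSpace ℝ (Fin d)
  | 0 => X₀
  | k + 1 => fun ω =>
      linearSA A b w α X₀ k ω + α • (matVec A (linearSA A b w α X₀ k ω) + b + w k ω)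

/-- The centered scaled iterates `Y k = (X k - x*) / √α`. -/
def scaledSA {Ω : Type*} {d : ℕ} (A : Matrix (Fin d) (Fin d) ℝ)
    (b xs : EuclideanSpace ℝ (Fin d)) (w : ℕ → Ω → EuclideanSpace ℝ (Fin d)) (α : ℝ)
    (X₀ : Ω → EuclideanSpace ℝ (Fin d)) (k : ℕ) (ω : Ω) : EuclideanSpace ℝ (Fin d) :=
  (√α)⁻¹ • (linearSA A b w α X₀ k ω - xs)

/-- `ρ` is a stationary law of the recursion `Y ↦ Y + α A Y + √α w`, where `w` has law `μ` and is
independent of `Y`. -/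
def IsStationaryLaw {d : ℕ} (A : Matrix (Fin d) (Fin d) ℝ) (α : ℝ)
    (μ ρ : Measure (EuclideanSpace ℝ (Fin d))) : Prop :=
  (ρ.prod μ).map (fun p => p.1 + α • matVec A p.1 + √α • p.2) = ρ

/-- The law `ν` of a random vector `Y` solves
`E[(tᵀ S t - 2 i tᵀ A Y) exp(i tᵀ Y)] = 0` for all `t`; the expectations are required to exist. -/
def SolvesLimitEq {d : ℕ} (A S : Matrix (Fin d) (Fin d) ℝ)
    (ν : Measure (EuclideanSpace ℝ (Fin d))) : Prop :=
  ∀ t : EuclideanSpace ℝ (Fin d),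
    Integrable (fun y : EuclideanSpace ℝ (Fin d) =>
      (((inner ℝ t (matVec S t) : ℝ) : ℂ) - 2 * Complex.I * ((inner ℝ t (matVec A y) : ℝ) : ℂ)) *
        Complex.exp (Complex.I * ((inner ℝ t y : ℝ) : ℂ))) ν ∧
    ∫ y : EuclideanSpace ℝ (Fin d),
      (((inner ℝ t (matVec S t) : ℝ) : ℂ) - 2 * Complex.I * ((inner ℝ t (matVec A y) : ℝ) : ℂ)) *
        Complex.exp (Complex.I * ((inner ℝ t y : ℝ) : ℂ)) ∂ν = 0

end

/-!
The recursion `Y ↦ (1 + α A) Y + √α w` is an affine random recursion, and everything is read off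
from characteristic functions along the orbits of the adjoint `R = 1 + α Aᵀ`.

*Lyapunov function.* The Cayley transform `C = (1 - A)⁻¹ (1 + A)` of a Hurwitz matrix has spectrum in
the open unit disc, hence `C ^ n → 0` by Gelfand's formula. In terms of `C` the Lyapunov equation
`A V + V Aᵀ + S = 0` reads `C V Cᵀ = V - (positive definite)`; iterating this gives uniqueness,
hence existence, and positivity of `V` (`IsHurwitz.exists_lyapunov`). The quadratic form
`q t = ⟪t, V t⟫` then satisfies `q (R t) + α c ‖t‖² ≤ q t` for all small `α`
(`exists_lyapunov_decrease`). This inequality gives the threshold, the geometric decay of the powers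
of `R`, and the bound `∑ α ‖R ^ j t‖² ≤ q t / c`, which is uniform in `α`.

*Stationary law.* The series `∑ (1 + α A) ^ j √α w j` converges in `L²`. Its partial sums have the law
of the iterates started at zero, because reversing the order of i.i.d. noise does not change laws, and
the contribution of the initial value tends to zero surely, whatever its dependence on the noise
(`tendstoInDistribution_affine_iterates`). The characteristic function `ψ` of the sum satisfies
`ψ t = ψ (R t) φ (√α t)`, with `φ` that of the noise; this is stationarity.

*Gaussian limit.* The function `exp (-q / 2)` satisfies the same fixed point equation up to an error
`o(α ‖t‖²)` per step, by the second-order expansion of `φ`. Telescoping along the orbit of `t` and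
using the uniform bound on `∑ α ‖R ^ j t‖²` yields `ψ t → exp (-q t / 2)` as `α → 0`
(`exists_norm_fixedPoint_sub_gaussian_le`), and Lévy's continuity theorem turns this into weak
convergence to the centered Gaussian law with covariance `V`. The limit equation follows by
differentiating its characteristic function in the direction `Aᵀ t`. The limit is thus identified
directly, so its normality does not rely on uniqueness for the limit equation.
-/

/-! ### The Lyapunov equation for Hurwitz matrices -/

section LyapunovEquation

open scoped Matrix.Norms.Frobenius ENNReal NNReal

/-- By Gelfand's formula, `‖a ^ n‖` is eventually at most `r ^ n` for any `r` strictly between the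
spectral radius and `1`. -/
lemma tendsto_pow_zero_of_spectrum_lt_one {R : Type*} [NormedRing R] [NormedAlgebra ℂ R]
    [CompleteSpace R] (a : R) (h : ∀ z ∈ spectrum ℂ a, ‖z‖ < 1) :
    Tendsto (fun n : ℕ => a ^ n) atTop (𝓝 0) := by
  have hρ : spectralRadius ℂ a < 1 := by
    rcases (spectrum ℂ a).eq_empty_or_nonempty with he | hne
    · simp [spectralRadius, he]
    · exact_mod_cast spectrum.spectralRadius_lt_of_forall_lt_of_nonempty hne (r := 1)
        fun z hz => by exact_mod_cast h z hz
  obtain ⟨r, hr, hr1⟩ := ENNReal.lt_iff_exists_nnreal_btwn.1 hρ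
  have hr1' : r < 1 := by exact_mod_cast hr1
  have hev := (spectrum.pow_nnnorm_pow_one_div_tendsto_nhds_spectralRadius a).eventually_lt_const hr
  rw [tendsto_zero_iff_norm_tendsto_zero]
  refine squeeze_zero' (Eventually.of_forall fun n => norm_nonneg _) ?_
    (tendsto_pow_atTop_nhds_zero_of_lt_one (r := (r : ℝ)) r.2 (by exact_mod_cast hr1'))
  filter_upwards [hev, eventually_gt_atTop 0] with n hn hn0
  have h1 := ENNReal.rpow_le_rpow hn.le (z := (n : ℝ)) (by positivity)
  rw [← ENNReal.rpow_mul, one_div, inv_mul_cancel₀ (by positivity), ENNReal.rpow_one,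
    ENNReal.rpow_natCast] at h1
  exact_mod_cast h1

variable {d : ℕ}

lemma IsHurwitz.isUnit_one_sub {A : Matrix (Fin d) (Fin d) ℝ} (hA : IsHurwitz A) :
    IsUnit (1 - A) := by
  have h1 : (1 : ℂ) ∉ spectrum ℂ (A.map (algebraMap ℝ ℂ)) := fun h => by
    have := hA 1 h
    norm_num at this
  rw [spectrum.notMem_iff, map_one] at h1
  rw [Matrix.isUnit_iff_isUnit_det] at h1 ⊢
  have h2 : (1 - A.map (algebraMap ℝ ℂ)) = (algebraMap ℝ ℂ).mapMatrix (1 - A) := by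
    rw [map_sub, map_one]; rfl
  rw [h2, ← RingHom.map_det] at h1
  rw [isUnit_iff_ne_zero] at h1 ⊢
  exact fun h => h1 (by rw [h, map_zero])

/-- The Cayley transform maps the open left half-plane to the open unit disc, so the Cayley
transform of a Hurwitz matrix has powers tending to zero. -/
lemma IsHurwitz.tendsto_cayley_pow {A : Matrix (Fin d) (Fin d) ℝ} (hA : IsHurwitz A) :
    Tendsto (fun n : ℕ => ((1 - A)⁻¹ * (1 + A)) ^ n) atTop (𝓝 0) := by
  set f := (algebraMap ℝ ℂ).mapMatrix (m := Fin d)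
  have hdet : IsUnit (1 - A).det := (Matrix.isUnit_iff_isUnit_det _).1 hA.isUnit_one_sub
  have hspec : ∀ z ∈ spectrum ℂ (f ((1 - A)⁻¹ * (1 + A))), ‖z‖ < 1 := by
    intro z hz
    rw [← Matrix.spectrum_toLin', ← Module.End.hasEigenvalue_iff_mem_spectrum] at hz
    obtain ⟨v, hv⟩ := hz.exists_hasEigenvector
    have hv0 := hv.2
    have hv1 : f ((1 - A)⁻¹ * (1 + A)) *ᵥ v = z • v := by
      simpa only [Matrix.toLin'_apply] using hv.apply_eq_smul
    have hv2 : f (1 + A) *ᵥ v = z • (f (1 - A) *ᵥ v) := by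
      rw [← Matrix.mulVec_smul, ← hv1, Matrix.mulVec_mulVec, ← map_mul, ← mul_assoc,
        Matrix.mul_nonsing_inv _ hdet, one_mul]
    have hv3 : (1 + z) • (f A *ᵥ v) = (z - 1) • v := by
      simp only [map_add, map_sub, map_one, Matrix.add_mulVec, Matrix.sub_mulVec,
        Matrix.one_mulVec] at hv2
      rw [smul_sub] at hv2
      rw [add_smul, sub_smul, one_smul, one_smul]
      linear_combination (exp := 1) hv2
    have hz1 : 1 + z ≠ 0 := by
      intro h0
      rw [h0, zero_smul, eq_comm, smul_eq_zero] at hv3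
      rcases hv3 with h | h
      · have : (2 : ℂ) = 0 := by linear_combination h0 - h
        norm_num at this
      · exact hv0 h
    have hv4 : f A *ᵥ v = ((z - 1) / (1 + z)) • v := by
      rw [div_eq_inv_mul, mul_smul, ← hv3, smul_smul, inv_mul_cancel₀ hz1, one_smul]
    have hmem : (z - 1) / (1 + z) ∈ spectrum ℂ (A.map (algebraMap ℝ ℂ)) := by
      rw [← Matrix.spectrum_toLin', ← Module.End.hasEigenvalue_iff_mem_spectrum]
      refine Module.End.hasEigenvalue_of_hasEigenvector (x := v) ⟨?_, hv0⟩
      rw [Module.End.mem_eigenspace_iff]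
      rw [Matrix.toLin'_apply]
      exact hv4
    have hre := hA _ hmem
    -- `Re ((z - 1) / (1 + z))` has the sign of `|z|² - 1`.
    rw [Complex.div_re, ← add_div, div_neg_iff] at hre
    have hn : 0 < Complex.normSq (1 + z) := Complex.normSq_pos.2 hz1
    have h5 : (z - 1).re * (1 + z).re + (z - 1).im * (1 + z).im < 0 := by
      rcases hre with h | h
      · exact absurd h.2 (not_lt.2 hn.le)
      · exact h.1
    simp only [Complex.sub_re, Complex.one_re, Complex.add_re, Complex.sub_im, Complex.one_im,
      Complex.add_im] at h5
    have h6 : ‖z‖ ^ 2 < 1 := by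
      rw [← Complex.normSq_eq_norm_sq, Complex.normSq_apply]
      linarith
    nlinarith [norm_nonneg z]
  have h := (tendsto_pow_zero_of_spectrum_lt_one _ hspec)
  rw [tendsto_zero_iff_norm_tendsto_zero] at h
  refine tendsto_zero_iff_norm_tendsto_zero.2 (h.congr fun n => ?_)
  rw [← map_pow]
  exact Matrix.frobenius_norm_map_eq _ _ fun a => by simp

/-- The Lyapunov equation `A V + V Aᵀ = -W` in terms of the Cayley transform of `A`. -/
lemma cayley_mul_mul_transpose {A V W : Matrix (Fin d) (Fin d) ℝ} (hA : IsUnit (1 - A))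
    (h : A * V + V * Aᵀ + W = 0) :
    ((1 - A)⁻¹ * (1 + A)) * V * ((1 - A)⁻¹ * (1 + A))ᵀ =
      V - (2 : ℝ) • ((1 - A)⁻¹ * W * ((1 - A)⁻¹)ᵀ) := by
  have hdet : IsUnit (1 - A).det := (Matrix.isUnit_iff_isUnit_det _).1 hA
  have h1 : (1 + A) * V * (1 + A)ᵀ = (1 - A) * V * (1 - A)ᵀ - (2 : ℝ) • W := by
    have hW : W = -(A * V + V * Aᵀ) := by rw [eq_neg_iff_add_eq_zero, add_comm]; exact h
    rw [hW, two_smul, Matrix.transpose_add, Matrix.transpose_sub, Matrix.transpose_one]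
    noncomm_ring
  have h2 : (1 - A)ᵀ * ((1 - A)⁻¹)ᵀ = 1 := by
    rw [← Matrix.transpose_mul, Matrix.nonsing_inv_mul _ hdet, Matrix.transpose_one]
  calc ((1 - A)⁻¹ * (1 + A)) * V * ((1 - A)⁻¹ * (1 + A))ᵀ
      = (1 - A)⁻¹ * ((1 + A) * V * (1 + A)ᵀ) * ((1 - A)⁻¹)ᵀ := by
        rw [Matrix.transpose_mul]; simp only [Matrix.mul_assoc]
    _ = ((1 - A)⁻¹ * (1 - A)) * V * ((1 - A)ᵀ * ((1 - A)⁻¹)ᵀ)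
          - (2 : ℝ) • ((1 - A)⁻¹ * W * ((1 - A)⁻¹)ᵀ) := by
        rw [h1, Matrix.mul_sub, Matrix.sub_mul, Matrix.mul_smul, Matrix.smul_mul]
        simp only [Matrix.mul_assoc]
    _ = _ := by rw [h2, Matrix.nonsing_inv_mul _ hdet, Matrix.one_mul, Matrix.mul_one]

lemma IsHurwitz.eq_zero_of_lyapunov {A V : Matrix (Fin d) (Fin d) ℝ} (hA : IsHurwitz A)
    (h : A * V + V * Aᵀ = 0) : V = 0 := by
  have hc := cayley_mul_mul_transpose (W := 0) hA.isUnit_one_sub (by rwa [add_zero])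
  have ht := hA.tendsto_cayley_pow
  set C := (1 - A)⁻¹ * (1 + A)
  simp only [Matrix.mul_zero, Matrix.zero_mul, smul_zero, sub_zero] at hc
  have hn : ∀ n : ℕ, C ^ n * V * (C ^ n)ᵀ = V := by
    intro n
    induction n with
    | zero => simp
    | succ n ih =>
      calc C ^ (n + 1) * V * (C ^ (n + 1))ᵀ = C ^ n * (C * V * Cᵀ) * (C ^ n)ᵀ := by
            rw [pow_succ, Matrix.transpose_mul]; simp only [Matrix.mul_assoc]
        _ = V := by rw [hc, ih]
  have ht' : Tendsto (fun n : ℕ => C ^ n * V * (C ^ n)ᵀ) atTop (𝓝 (0 * V * 0ᵀ)) :=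
    (ht.mul_const V).mul ((Continuous.matrix_transpose continuous_id).continuousAt.tendsto.comp ht)
  simp only [hn] at ht'
  simpa using tendsto_nhds_unique tendsto_const_nhds ht'

/-- **Lyapunov's theorem**: for a Hurwitz matrix `A` and a positive definite `S`, the Lyapunov
equation has exactly one solution, and it is positive definite. -/
theorem IsHurwitz.exists_lyapunov {A S : Matrix (Fin d) (Fin d) ℝ} (hA : IsHurwitz A)
    (hS : S.PosDef) :
    ∃ V : Matrix (Fin d) (Fin d) ℝ, A * V + V * Aᵀ + S = 0 ∧ V.PosDef ∧
      ∀ U : Matrix (Fin d) (Fin d) ℝ, A * U + U * Aᵀ + S = 0 → U = V := by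
  let L : Matrix (Fin d) (Fin d) ℝ →ₗ[ℝ] Matrix (Fin d) (Fin d) ℝ :=
    LinearMap.mulLeft ℝ A + LinearMap.mulRight ℝ Aᵀ
  have hL : ∀ V, L V = A * V + V * Aᵀ := fun V => rfl
  have hinj : Function.Injective L := by
    rw [← LinearMap.ker_eq_bot, LinearMap.ker_eq_bot']
    exact fun V hV => hA.eq_zero_of_lyapunov hV
  obtain ⟨V, hV⟩ := (LinearMap.injective_iff_surjective.1 hinj) (-S)
  have hV' : A * V + V * Aᵀ + S = 0 := by rw [← hL, hV, neg_add_cancel]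
  have huniq : ∀ U : Matrix (Fin d) (Fin d) ℝ, A * U + U * Aᵀ + S = 0 → U = V := by
    intro U hU
    apply hinj
    rw [hV, hL]
    exact eq_neg_of_add_eq_zero_left hU
  have hSt : Sᵀ = S := hS.isHermitian
  have hVt : Vᵀ = V := by
    apply huniq
    have := congrArg Matrix.transpose hV'
    rw [Matrix.transpose_add, Matrix.transpose_add, Matrix.transpose_mul, Matrix.transpose_mul,
      Matrix.transpose_transpose, hSt, Matrix.transpose_zero] at this
    rw [← this]
    abel
  refine ⟨V, hV', .of_dotProduct_mulVec_pos hVt fun x hx => ?_, huniq⟩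
  rw [star_trivial]
  have hc := cayley_mul_mul_transpose hA.isUnit_one_sub hV'
  have ht := hA.tendsto_cayley_pow
  set C := (1 - A)⁻¹ * (1 + A)
  set D := (1 - A)⁻¹
  have hDt : IsUnit Dᵀ := by
    rw [Matrix.isUnit_transpose]
    exact (Matrix.isUnit_nonsing_inv_iff).2 hA.isUnit_one_sub
  have hquad : ∀ (M N : Matrix (Fin d) (Fin d) ℝ) (y : Fin d → ℝ),
      y ⬝ᵥ (M * N * Mᵀ) *ᵥ y = (Mᵀ *ᵥ y) ⬝ᵥ N *ᵥ (Mᵀ *ᵥ y) := by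
    intro M N y
    rw [← Matrix.mulVec_mulVec, ← Matrix.mulVec_mulVec, Matrix.dotProduct_mulVec,
      ← Matrix.mulVec_transpose]
  -- The form of `V` decreases along `y ↦ Cᵀ y`, whose orbits tend to zero.
  have hstep : ∀ y : Fin d → ℝ, y ⬝ᵥ V *ᵥ y =
      (Cᵀ *ᵥ y) ⬝ᵥ V *ᵥ (Cᵀ *ᵥ y) + 2 * ((Dᵀ *ᵥ y) ⬝ᵥ S *ᵥ (Dᵀ *ᵥ y)) := by
    intro y
    rw [← hquad, ← hquad, hc, Matrix.sub_mulVec, Matrix.smul_mulVec, dotProduct_sub,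
      dotProduct_smul, smul_eq_mul]
    ring
  have hSnn : ∀ y : Fin d → ℝ, 0 ≤ y ⬝ᵥ S *ᵥ y := fun y => by
    simpa using hS.posSemidef.dotProduct_mulVec_nonneg y
  have hmono : ∀ (n : ℕ) (y : Fin d → ℝ),
      ((C ^ n)ᵀ *ᵥ y) ⬝ᵥ V *ᵥ ((C ^ n)ᵀ *ᵥ y) ≤ y ⬝ᵥ V *ᵥ y := by
    intro n
    induction n with
    | zero => intro y; simp
    | succ n ih =>
      intro y
      rw [hstep y, pow_succ', Matrix.transpose_mul, ← Matrix.mulVec_mulVec]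
      linarith [ih (Cᵀ *ᵥ y), hSnn (Dᵀ *ᵥ y)]
  have hlim : Tendsto (fun n : ℕ => ((C ^ n)ᵀ *ᵥ (Cᵀ *ᵥ x)) ⬝ᵥ V *ᵥ ((C ^ n)ᵀ *ᵥ (Cᵀ *ᵥ x)))
      atTop (𝓝 0) := by
    have hcont : Continuous fun M : Matrix (Fin d) (Fin d) ℝ =>
        (Mᵀ *ᵥ (Cᵀ *ᵥ x)) ⬝ᵥ V *ᵥ (Mᵀ *ᵥ (Cᵀ *ᵥ x)) := by
      fun_prop
    have h0 := (hcont.tendsto 0).comp ht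
    rwa [Matrix.transpose_zero, Matrix.zero_mulVec, zero_dotProduct] at h0
  have hge : 0 ≤ (Cᵀ *ᵥ x) ⬝ᵥ V *ᵥ (Cᵀ *ᵥ x) := le_of_tendsto' hlim fun n => hmono n _
  have hDx : Dᵀ *ᵥ x ≠ 0 := fun h =>
    hx (Matrix.mulVec_injective_of_isUnit hDt (by rw [h, Matrix.mulVec_zero]))
  have hpos : 0 < (Dᵀ *ᵥ x) ⬝ᵥ S *ᵥ (Dᵀ *ᵥ x) := by
    simpa using hS.dotProduct_mulVec_pos hDx
  rw [hstep x]
  linarith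

end LyapunovEquation

/-! ### Quadratic Lyapunov functions of linear maps -/

section QuadraticForms

open scoped RealInnerProductSpace

variable {E : Type*} [NormedAddCommGroup E] [InnerProductSpace ℝ E]

/-- A positive definite quadratic form in finite dimension is coercive. -/
lemma exists_mul_norm_sq_le_inner_self [FiniteDimensional ℝ E] (V : E →L[ℝ] E)
    (hV : ∀ t, t ≠ 0 → 0 < ⟪t, V t⟫) : ∃ c : ℝ, 0 < c ∧ ∀ t, c * ‖t‖ ^ 2 ≤ ⟪t, V t⟫ := by
  by_cases hne : (Metric.sphere (0 : E) 1).Nonempty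
  · obtain ⟨u, hu, hmin⟩ := (isCompact_sphere (0 : E) 1).exists_isMinOn hne
      (f := fun t => ⟪t, V t⟫) (by fun_prop)
    have hu0 : u ≠ 0 := by
      rintro rfl
      simp at hu
    refine ⟨⟪u, V u⟫, hV u hu0, fun t => ?_⟩
    rcases eq_or_ne t 0 with rfl | ht
    · simp
    have hn : ‖t‖ ≠ 0 := norm_ne_zero_iff.2 ht
    have hs : ‖t‖⁻¹ • t ∈ Metric.sphere (0 : E) 1 := by
      simp [norm_smul, hn]
    have h := hmin hs
    simp only [Set.mem_ofPred_eq, map_smul, real_inner_smul_left, real_inner_smul_right] at h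
    calc ⟪u, V u⟫ * ‖t‖ ^ 2 ≤ (‖t‖⁻¹ * (‖t‖⁻¹ * ⟪t, V t⟫)) * ‖t‖ ^ 2 := by gcongr
      _ = ⟪t, V t⟫ := by field_simp
  · refine ⟨1, one_pos, fun t => ?_⟩
    have ht : t = 0 := by
      by_contra ht
      exact hne ⟨‖t‖⁻¹ • t, by simp [norm_smul, ht]⟩
    simp [ht]

lemma inner_apply_self_le (V : E →L[ℝ] E) (t : E) : ⟪t, V t⟫ ≤ ‖V‖ * ‖t‖ ^ 2 :=
  calc ⟪t, V t⟫ ≤ ‖t‖ * ‖V t‖ := real_inner_le_norm _ _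
    _ ≤ ‖t‖ * (‖V‖ * ‖t‖) := by gcongr; exact V.le_opNorm t
    _ = ‖V‖ * ‖t‖ ^ 2 := by ring

/-- `hL` is the Lyapunov equation `Tᵀ V + V T = -S` in terms of quadratic forms. -/
lemma inner_one_add_smul_apply_self {V S T : E →L[ℝ] E}
    (hL : ∀ t, ⟪T t, V t⟫ + ⟪t, V (T t)⟫ = -⟪t, S t⟫) (α : ℝ) (t : E) :
    ⟪(1 + α • T) t, V ((1 + α • T) t)⟫ = ⟪t, V t⟫ - α * ⟪t, S t⟫ + α ^ 2 * ⟪T t, V (T t)⟫ := by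
  simp only [_root_.add_apply, one_apply_eq_self,
    _root_.smul_apply, map_add, map_smul, inner_add_left, inner_add_right,
    real_inner_smul_left, real_inner_smul_right]
  linear_combination α * hL t

/-- The quadratic form of a solution of the Lyapunov equation decreases along the Euler steps
`t ↦ t + α T t`, for all small `α`. -/
lemma exists_lyapunov_decrease [FiniteDimensional ℝ E] {V S T : E →L[ℝ] E}
    (hS : ∀ t, t ≠ 0 → 0 < ⟪t, S t⟫) (hL : ∀ t, ⟪T t, V t⟫ + ⟪t, V (T t)⟫ = -⟪t, S t⟫) :
    ∃ a : ℝ, 0 < a ∧ ∃ c : ℝ, 0 < c ∧ ∀ α ∈ Set.Ioo 0 a, ∀ t,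
      ⟪(1 + α • T) t, V ((1 + α • T) t)⟫ + α * c * ‖t‖ ^ 2 ≤ ⟪t, V t⟫ := by
  obtain ⟨c, hc, hcS⟩ := exists_mul_norm_sq_le_inner_self S hS
  -- The second-order term `α² ⟪T t, V (T t)⟫` absorbs at most half of `α ⟪t, S t⟫`.
  set M : ℝ := ‖V‖ * ‖T‖ ^ 2 + 1
  have hM : 0 < M := by positivity
  refine ⟨c / (2 * M), by positivity, c / 2, by positivity, fun α hα t => ?_⟩
  have h1 : ⟪T t, V (T t)⟫ ≤ M * ‖t‖ ^ 2 := by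
    calc ⟪T t, V (T t)⟫ ≤ ‖V‖ * ‖T t‖ ^ 2 := inner_apply_self_le V _
      _ ≤ ‖V‖ * (‖T‖ * ‖t‖) ^ 2 := by gcongr; exact T.le_opNorm t
      _ ≤ M * ‖t‖ ^ 2 := by
        rw [mul_pow, ← mul_assoc]
        gcongr
        simp [M]
  have h2 : α * M ≤ c / 2 := by
    have := hα.2.le
    rw [le_div_iff₀ (by positivity)] at this
    linarith
  rw [inner_one_add_smul_apply_self hL]
  have h3 : α * (c * ‖t‖ ^ 2) ≤ α * ⟪t, S t⟫ := mul_le_mul_of_nonneg_left (hcS t) hα.1.le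
  have h4 : α ^ 2 * ⟪T t, V (T t)⟫ ≤ α * (c / 2) * ‖t‖ ^ 2 := by
    calc α ^ 2 * ⟪T t, V (T t)⟫ ≤ α ^ 2 * (M * ‖t‖ ^ 2) := by gcongr
      _ = α * (α * M) * ‖t‖ ^ 2 := by ring
      _ ≤ α * (c / 2) * ‖t‖ ^ 2 := by have := hα.1; gcongr
  linarith

variable {V R : E →L[ℝ] E} {m δ : ℝ}

/-- The decrements of the Lyapunov function along an orbit add up to at most its initial value. -/
lemma sum_norm_sq_pow_apply_le (hV : ∀ t, m * ‖t‖ ^ 2 ≤ ⟪t, V t⟫) (hm : 0 < m)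
    (hR : ∀ t, ⟪R t, V (R t)⟫ + δ * ‖t‖ ^ 2 ≤ ⟪t, V t⟫) (n : ℕ) (t : E) :
    ∑ j ∈ Finset.range n, δ * ‖(R ^ j) t‖ ^ 2 ≤ ⟪t, V t⟫ := by
  suffices h : ∑ j ∈ Finset.range n, δ * ‖(R ^ j) t‖ ^ 2 + ⟪(R ^ n) t, V ((R ^ n) t)⟫ ≤ ⟪t, V t⟫ by
    have : 0 ≤ ⟪(R ^ n) t, V ((R ^ n) t)⟫ := le_trans (by positivity) (hV _)
    linarith
  induction n with
  | zero => simp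
  | succ n ih =>
    rw [Finset.sum_range_succ, pow_succ' R, mul_apply_eq_comp]
    linarith [hR ((R ^ n) t)]

lemma norm_sq_pow_apply_le (hV : ∀ t, m * ‖t‖ ^ 2 ≤ ⟪t, V t⟫) (hm : 0 < m) (hδ : 0 < δ)
    (hR : ∀ t, ⟪R t, V (R t)⟫ + δ * ‖t‖ ^ 2 ≤ ⟪t, V t⟫) (n : ℕ) (t : E) :
    ‖(R ^ n) t‖ ^ 2 ≤ ⟪t, V t⟫ / m := by
  rw [le_div_iff₀' hm]
  refine (hV _).trans ?_
  induction n with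
  | zero => simp
  | succ n ih =>
    rw [pow_succ' R, mul_apply_eq_comp]
    have : 0 ≤ δ * ‖(R ^ n) t‖ ^ 2 := by positivity
    linarith [hR ((R ^ n) t)]

/-- A strict Lyapunov function makes the powers of `R` decay geometrically. -/
lemma summable_norm_pow_of_lyapunov_decrease (hV : ∀ t, m * ‖t‖ ^ 2 ≤ ⟪t, V t⟫) (hm : 0 < m)
    (hδ : 0 < δ) (hR : ∀ t, ⟪R t, V (R t)⟫ + δ * ‖t‖ ^ 2 ≤ ⟪t, V t⟫) :
    Summable fun n : ℕ => ‖R ^ n‖ := by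
  set K : ℝ := ‖V‖ + δ
  have hK : 0 < K := by positivity
  set r : ℝ := 1 - δ / K
  have hr0 : 0 ≤ r := by
    have : δ / K ≤ 1 := (div_le_one hK).2 (by simp [K])
    simp only [r]; linarith
  have hr1 : r < 1 := by
    have : 0 < δ / K := by positivity
    simp only [r]; linarith
  have hVK : ∀ t, ⟪t, V t⟫ ≤ K * ‖t‖ ^ 2 := fun t =>
    (inner_apply_self_le V t).trans (by gcongr; simp only [K]; linarith)
  have hstep : ∀ t, ⟪R t, V (R t)⟫ ≤ r * ⟪t, V t⟫ := by
    intro t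
    have h1 : δ / K * ⟪t, V t⟫ ≤ δ * ‖t‖ ^ 2 :=
      calc δ / K * ⟪t, V t⟫ ≤ δ / K * (K * ‖t‖ ^ 2) := by gcongr; exact hVK t
        _ = δ * ‖t‖ ^ 2 := by field_simp
    have h2 := hR t
    simp only [r]
    linarith
  have hpow : ∀ (n : ℕ) t, ⟪(R ^ n) t, V ((R ^ n) t)⟫ ≤ r ^ n * ⟪t, V t⟫ := by
    intro n t
    induction n with
    | zero => simp
    | succ n ih =>
      rw [pow_succ' R, mul_apply_eq_comp, pow_succ', mul_assoc]
      exact (hstep _).trans (by gcongr)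
  have hnorm : ∀ n : ℕ, ‖R ^ n‖ ≤ √(K / m) * √r ^ n := by
    intro n
    refine ContinuousLinearMap.opNorm_le_bound _ (by positivity) fun t => ?_
    refine le_of_sq_le_sq ?_ (by positivity)
    have h1 : (√(K / m) * √r ^ n * ‖t‖) ^ 2 = r ^ n * (K * ‖t‖ ^ 2) / m := by
      rw [mul_pow, mul_pow, Real.sq_sqrt (by positivity), ← pow_mul, mul_comm n 2, pow_mul,
        Real.sq_sqrt hr0]
      ring
    rw [h1, le_div_iff₀' hm]
    exact (hV _).trans ((hpow n t).trans (by gcongr; exact hVK t))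
  exact Summable.of_nonneg_of_le (fun n => norm_nonneg _) hnorm
    ((summable_geometric_of_lt_one (Real.sqrt_nonneg r)
      ((Real.sqrt_lt' one_pos).2 (by simpa using hr1))).mul_left _)

end QuadraticForms

/-! ### Expansion and gradient of characteristic functions -/

section CharacteristicFunctions

open scoped RealInnerProductSpace
open Complex (I)

lemma norm_exp_mul_I_sub_taylor_le_cube {x : ℝ} (hx : |x| ≤ 1) :
    ‖Complex.exp (x * I) - 1 - x * I + (x : ℂ) ^ 2 / 2‖ ≤ |x| ^ 3 := by
  have hn : ‖(x * I : ℂ)‖ = |x| := by simp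
  have h := Complex.exp_bound (x := x * I) (by rwa [hn]) (n := 3) (by norm_num)
  rw [hn] at h
  have he : Complex.exp (x * I) - 1 - x * I + (x : ℂ) ^ 2 / 2 =
      Complex.exp (x * I) - ∑ m ∈ Finset.range 3, (x * I : ℂ) ^ m / (m.factorial : ℂ) := by
    simp only [Finset.sum_range_succ, Finset.sum_range_zero, Nat.factorial, mul_pow, Complex.I_sq]
    push_cast
    ring
  rw [he]
  refine h.trans ?_
  have : (3 : ℕ).succ * ((3 : ℕ).factorial * (3 : ℕ) : ℝ)⁻¹ ≤ 1 := by norm_num [Nat.factorial]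
  exact (mul_le_mul_of_nonneg_left this (by positivity)).trans (by simp)

lemma norm_exp_mul_I_sub_taylor_le_sq (x : ℝ) :
    ‖Complex.exp (x * I) - 1 - x * I + (x : ℂ) ^ 2 / 2‖ ≤ 4 * x ^ 2 := by
  rcases le_or_gt |x| 1 with hx | hx
  · refine (norm_exp_mul_I_sub_taylor_le_cube hx).trans ?_
    rw [← sq_abs x]
    nlinarith [pow_nonneg (abs_nonneg x) 2]
  · have h1 : ‖Complex.exp (x * I) - 1 - x * I + (x : ℂ) ^ 2 / 2‖ ≤ 1 + 1 + |x| + |x| ^ 2 / 2 := by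
      refine (norm_add_le _ _).trans (add_le_add ((norm_sub_le _ _).trans (add_le_add
        ((norm_sub_le _ _).trans (add_le_add ?_ ?_)) ?_)) ?_)
      · rw [Complex.norm_exp_ofReal_mul_I]
      · simp
      · simp
      · simp
    rw [← sq_abs x]
    nlinarith

variable {E : Type*} [NormedAddCommGroup E] [InnerProductSpace ℝ E] [MeasurableSpace E]
  [BorelSpace E] [SecondCountableTopology E]

/-- Second-order expansion at the origin of the characteristic function of a centered
square-integrable law, uniformly in the direction. -/
lemma charFun_sub_taylor_isLittleO [CompleteSpace E] {μ : Measure E} [IsProbabilityMeasure μ]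
    (hμ : MemLp id 2 μ) (h0 : ∫ y, y ∂μ = 0) :
    (fun u : E => charFun μ u - 1 + ((∫ y, ⟪y, u⟫ ^ 2 ∂μ : ℝ) : ℂ) / 2) =o[𝓝 0]
      fun u => ‖u‖ ^ 2 := by
  have hsq : Integrable (fun y : E => ‖y‖ ^ 2) μ := hμ.integrable_norm_pow (by norm_num)
  have hid : Integrable (fun y : E => y) μ := hμ.integrable (by norm_num)
  have hint : ∀ u : E, charFun μ u - 1 + ((∫ y, ⟪y, u⟫ ^ 2 ∂μ : ℝ) : ℂ) / 2 =
      ∫ y, (Complex.exp (⟪y, u⟫ * I) - 1 - ⟪y, u⟫ * I + (⟪y, u⟫ : ℂ) ^ 2 / 2) ∂μ := by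
    intro u
    have i1 : Integrable (fun y : E => Complex.exp (⟪y, u⟫ * I)) μ :=
      (integrable_const (1 : ℝ)).mono' (by fun_prop)
        (Eventually.of_forall fun y => by simp [Complex.norm_exp_ofReal_mul_I])
    have i2 : Integrable (fun y : E => ⟪y, u⟫) μ := hid.inner_const u
    have i3 : Integrable (fun y : E => ⟪y, u⟫ ^ 2) μ := by
      refine (hsq.mul_const (‖u‖ ^ 2)).mono' (by fun_prop) (Eventually.of_forall fun y => ?_)
      rw [Real.norm_eq_abs, abs_pow, ← mul_pow]
      gcongr
      exact abs_real_inner_le_norm y u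
    have i3' : Integrable (fun y : E => (⟪y, u⟫ : ℂ) ^ 2 / 2) μ := by
      simpa using (i3.ofReal (𝕜 := ℂ)).div_const 2
    have hm : ∫ y, ⟪y, u⟫ ∂μ = 0 := by
      simp_rw [real_inner_comm u]
      rw [integral_inner hid, h0, inner_zero_right]
    have i2' : Integrable (fun y : E => (⟪y, u⟫ : ℂ) * I) μ := i2.ofReal.mul_const I
    have i4 : Integrable (fun y : E => Complex.exp (⟪y, u⟫ * I) - 1) μ :=
      i1.sub (integrable_const _)
    have i5 : Integrable (fun y : E => Complex.exp (⟪y, u⟫ * I) - 1 - ⟪y, u⟫ * I) μ := i4.sub i2'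
    rw [integral_add i5 i3', integral_sub i4 i2', integral_sub i1 (integrable_const _),
      integral_mul_const, integral_complex_ofReal, hm, integral_div, charFun_apply]
    have : ∫ y, (⟪y, u⟫ : ℂ) ^ 2 ∂μ = ((∫ y, ⟪y, u⟫ ^ 2 ∂μ : ℝ) : ℂ) := by
      rw [← integral_complex_ofReal]; push_cast; rfl
    rw [this]
    simp
  rw [← Asymptotics.isLittleO_norm_left, Asymptotics.isLittleO_iff_tendsto'
    (Eventually.of_forall fun u hu => by
      have : u = 0 := by simpa using hu
      subst this
      simp)]
  have hlim : Tendsto (fun u : E => ∫ y, ‖Complex.exp (⟪y, u⟫ * I) - 1 - ⟪y, u⟫ * I +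
      (⟪y, u⟫ : ℂ) ^ 2 / 2‖ / ‖u‖ ^ 2 ∂μ) (𝓝 0) (𝓝 (∫ _, (0 : ℝ) ∂μ)) := by
    refine tendsto_integral_filter_of_dominated_convergence (fun y => 4 * ‖y‖ ^ 2)
      (Eventually.of_forall fun u => by fun_prop) (Eventually.of_forall fun u =>
        Eventually.of_forall fun y => ?_) (hsq.const_mul 4) (Eventually.of_forall fun y => ?_)
    · rw [Real.norm_of_nonneg (by positivity)]
      refine div_le_of_le_mul₀ (by positivity) (by positivity)
        ((norm_exp_mul_I_sub_taylor_le_sq _).trans ?_)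
      rw [mul_assoc, ← mul_pow, ← sq_abs ⟪y, u⟫]
      gcongr
      exact abs_real_inner_le_norm y u
    · have hc : Tendsto (fun u : E => ‖y‖ ^ 3 * ‖u‖) (𝓝 0) (𝓝 0) := by
        have h : Continuous fun u : E => ‖y‖ ^ 3 * ‖u‖ := by fun_prop
        simpa using h.tendsto 0
      have hi : ∀ᶠ u : E in 𝓝 0, |⟪y, u⟫| < 1 := by
        have h : Continuous fun u : E => |⟪y, u⟫| := by fun_prop
        exact (h.tendsto 0).eventually_lt_const (by simp)
      refine squeeze_zero' (Eventually.of_forall fun u => by positivity) ?_ hc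
      filter_upwards [hi] with u hu
      refine div_le_of_le_mul₀ (by positivity) (by positivity)
        ((norm_exp_mul_I_sub_taylor_le_cube hu.le).trans ?_)
      calc |⟪y, u⟫| ^ 3 ≤ (‖y‖ * ‖u‖) ^ 3 := by gcongr; exact abs_real_inner_le_norm y u
        _ = ‖y‖ ^ 3 * ‖u‖ * ‖u‖ ^ 2 := by ring
  rw [integral_zero] at hlim
  refine squeeze_zero (fun u => by positivity) (fun u => ?_) hlim
  rw [hint u, integral_div]
  gcongr
  exact norm_integral_le_integral_norm _

/-- If the characteristic function of `ν` is `exp (-⟪t, V t⟫ / 2)`, then its gradient is read off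
from both the integral and the exponential. -/
lemma integral_inner_mul_exp_of_charFun_eq {ν : Measure E} [IsProbabilityMeasure ν]
    (hν : MemLp id 2 ν) {V : E →L[ℝ] E} (hV : ∀ x y, ⟪x, V y⟫ = ⟪V x, y⟫)
    (hchar : ∀ t, charFun ν t = Complex.exp (-(⟪t, V t⟫ / 2 : ℝ))) (t v : E) :
    ∫ y, (⟪y, v⟫ : ℂ) * Complex.exp (⟪y, t⟫ * I) ∂ν = I * ⟪v, V t⟫ * charFun ν t := by
  have hν1 : MemLp id ((1 : ℕ) : ENNReal) ν := hν.mono_exponent (by norm_num)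
  have h1 := iteratedFDeriv_charFun (t := t) hν1 (fun _ : Fin 1 => v)
  rw [iteratedFDeriv_one_apply] at h1
  have hdiff : DifferentiableAt ℝ (charFun ν) t :=
    (contDiff_charFun hν1).differentiable (by simp) t
  have hline : HasDerivAt (fun s : ℝ => t + s • v) v 0 := by
    simpa using ((hasDerivAt_id (0 : ℝ)).smul_const v).const_add t
  have hd1 : HasDerivAt (fun s : ℝ => charFun ν (t + s • v)) (fderiv ℝ (charFun ν) t v) 0 := by
    have h : HasFDerivAt (charFun ν) (fderiv ℝ (charFun ν) t) (t + (0 : ℝ) • v) := by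
      simpa using hdiff.hasFDerivAt
    exact h.comp_hasDerivAt 0 hline
  have hquad : HasDerivAt (fun s : ℝ => -(⟪t + s • v, V (t + s • v)⟫ / 2)) (-⟪v, V t⟫) 0 := by
    have hVline : HasDerivAt (fun s : ℝ => V (t + s • v)) (V v) 0 :=
      V.hasFDerivAt.comp_hasDerivAt 0 hline
    have h := ((hline.inner ℝ hVline).div_const 2).neg
    refine h.congr_deriv ?_
    rw [zero_smul, add_zero, hV t v, real_inner_comm v]
    ring
  have hd2 : HasDerivAt (fun s : ℝ => charFun ν (t + s • v)) (charFun ν t * (-⟪v, V t⟫ : ℝ)) 0 := by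
    simp_rw [hchar]
    have h := hquad.ofReal_comp.cexp
    simpa using h
  have h2 := hd1.unique hd2
  rw [h1] at h2
  simp only [pow_one, Finset.univ_unique, Finset.prod_const, Finset.card_singleton] at h2
  push_cast at h2
  linear_combination (-I) * h2 + (∫ y, (⟪y, v⟫ : ℂ) * Complex.exp (⟪y, t⟫ * I) ∂ν) * Complex.I_sq

end CharacteristicFunctions

/-! ### Gaussian limit of the fixed points -/

section GaussianLimit

open scoped RealInnerProductSpace

variable {E : Type*} [NormedAddCommGroup E] [InnerProductSpace ℝ E] [FiniteDimensional ℝ E]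
  [MeasurableSpace E] [BorelSpace E] {μ : Measure E} [IsProbabilityMeasure μ]
  {V S T : E →L[ℝ] E} {a c m : ℝ}

/-- One step of the recursion multiplies the stationary characteristic function by
`charFun μ (√α • s)`, and `exp (-⟪s, V s⟫ / 2)` by the exponential below. Both factors are
`1 - α ⟪s, S s⟫ / 2 + o(α ‖s‖²)`, uniformly for bounded `s`. -/
lemma exists_norm_charFun_sub_exp_le (hμ : MemLp id 2 μ) (h0 : ∫ y, y ∂μ = 0)
    (hcov : ∀ u, ∫ y, ⟪y, u⟫ ^ 2 ∂μ = ⟪u, S u⟫) (hm : 0 < m) (hV : ∀ t, m * ‖t‖ ^ 2 ≤ ⟪t, V t⟫)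
    (hL : ∀ t, ⟪T t, V t⟫ + ⟪t, V (T t)⟫ = -⟪t, S t⟫) (hc : 0 < c)
    (hdec : ∀ α ∈ Set.Ioo 0 a, ∀ t,
      ⟪(1 + α • T) t, V ((1 + α • T) t)⟫ + α * c * ‖t‖ ^ 2 ≤ ⟪t, V t⟫)
    (r : ℝ) {ε : ℝ} (hε : 0 < ε) :
    ∃ δ : ℝ, 0 < δ ∧ ∀ α ∈ Set.Ioo 0 a, α < δ → ∀ s : E, ‖s‖ ^ 2 ≤ r →
      ‖charFun μ (√α • s) -
        Complex.exp (-((⟪s, V s⟫ - ⟪(1 + α • T) s, V ((1 + α • T) s)⟫) / 2 : ℝ))‖ ≤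
      ε * (α * ‖s‖ ^ 2) := by
  rcases lt_or_ge r 0 with hr | hr
  · exact ⟨1, one_pos, fun α _ _ s hs => absurd hs (not_le.2 (hr.trans_le (sq_nonneg _)))⟩
  have hlo := charFun_sub_taylor_isLittleO hμ h0
  rw [Asymptotics.isLittleO_iff] at hlo
  obtain ⟨ρ, hρ, hball⟩ := Metric.eventually_nhds_iff.1 (hlo (half_pos hε))
  simp only [hcov, dist_zero_right, norm_pow, norm_norm] at hball
  set M : ℝ := ‖V‖ * ‖T‖ ^ 2
  set K : ℝ := ‖S‖ * r / 2 + ‖S‖ ^ 2 * r / 4 + M / 2 + 1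
  have hM : 0 ≤ M := by positivity
  have hK : 0 < K := by positivity
  refine ⟨min (ρ ^ 2 / (r + 1)) (min (1 / K) (ε / (2 * K))), by positivity, ?_⟩
  intro α hα hαδ s hs
  have hα0 := hα.1
  -- The three conditions on `α` make the Taylor remainder of `charFun μ` small, the exponent at most
  -- `1`, and the terms of order `α²` small.
  have hα1 : α * (r + 1) < ρ ^ 2 :=
    (lt_div_iff₀ (by positivity)).1 (hαδ.trans_le (min_le_left _ _))
  have hα2 : α * K ≤ 1 :=
    ((lt_div_iff₀ hK).1 (hαδ.trans_le ((min_le_right _ _).trans (min_le_left _ _)))).le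
  have hα3 : α * K ≤ ε / 2 := by
    have := (lt_div_iff₀ (by positivity)).1
      (hαδ.trans_le ((min_le_right _ _).trans (min_le_right _ _)))
    linarith
  have hTs : ⟪T s, V (T s)⟫ ≤ M * ‖s‖ ^ 2 :=
    calc ⟪T s, V (T s)⟫ ≤ ‖V‖ * ‖T s‖ ^ 2 := inner_apply_self_le V _
      _ ≤ ‖V‖ * (‖T‖ * ‖s‖) ^ 2 := by gcongr; exact T.le_opNorm s
      _ = M * ‖s‖ ^ 2 := by simp only [M]; ring
  have hTs0 : 0 ≤ ⟪T s, V (T s)⟫ := le_trans (by positivity) (hV _)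
  have hSs := inner_apply_self_le S s
  have hx := inner_one_add_smul_apply_self hL α s
  set x : ℝ := (⟪s, V s⟫ - ⟪(1 + α • T) s, V ((1 + α • T) s)⟫) / 2
  have hxe : x = α * ⟪s, S s⟫ / 2 - α ^ 2 * ⟪T s, V (T s)⟫ / 2 := by
    simp only [x]; rw [hx]; ring
  have hx0 : 0 ≤ x := by
    have h1 := hdec α hα s
    have h2 : 0 ≤ α * c * ‖s‖ ^ 2 := by positivity
    simp only [x]; linarith
  have hxle : x ≤ α * (‖S‖ * ‖s‖ ^ 2) / 2 := by
    have h1 : α * ⟪s, S s⟫ ≤ α * (‖S‖ * ‖s‖ ^ 2) := by gcongr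
    have h2 : 0 ≤ α ^ 2 * ⟪T s, V (T s)⟫ := by positivity
    rw [hxe]; linarith
  have hx1 : |-x| ≤ 1 := by
    rw [abs_neg, abs_of_nonneg hx0]
    calc x ≤ α * (‖S‖ * ‖s‖ ^ 2) / 2 := hxle
      _ ≤ α * (‖S‖ * r) / 2 := by gcongr
      _ = α * (‖S‖ * r / 2) := by ring
      _ ≤ α * K := by
        gcongr
        have : 0 ≤ ‖S‖ ^ 2 * r / 4 + M / 2 + 1 := by positivity
        simp only [K]; linarith
      _ ≤ 1 := hα2
  have e1 : ‖charFun μ (√α • s) - 1 + ((α * ⟪s, S s⟫ : ℝ) : ℂ) / 2‖ ≤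
      ε / 2 * (α * ‖s‖ ^ 2) := by
    have hn : ‖√α • s‖ ^ 2 = α * ‖s‖ ^ 2 := by
      rw [norm_smul, mul_pow, Real.norm_of_nonneg (Real.sqrt_nonneg _), Real.sq_sqrt hα0.le]
    have hin : ⟪√α • s, S (√α • s)⟫ = α * ⟪s, S s⟫ := by
      rw [map_smul, real_inner_smul_left, real_inner_smul_right, ← mul_assoc,
        Real.mul_self_sqrt hα0.le]
    have h := hball (y := √α • s) (by
      refine lt_of_pow_lt_pow_left₀ 2 hρ.le ?_
      rw [hn]
      refine lt_of_le_of_lt ?_ hα1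
      gcongr
      linarith)
    rwa [hn, hin] at h
  have e2 : ‖((Real.exp (-x) - 1 - (-x) : ℝ) : ℂ)‖ ≤ α * (‖S‖ ^ 2 * r / 4) * (α * ‖s‖ ^ 2) := by
    rw [Complex.norm_real, Real.norm_eq_abs]
    refine (Real.abs_exp_sub_one_sub_id_le hx1).trans ?_
    rw [neg_sq]
    calc x ^ 2 ≤ (α * (‖S‖ * ‖s‖ ^ 2) / 2) ^ 2 := by gcongr
      _ = α * (‖S‖ ^ 2 * ‖s‖ ^ 2 / 4) * (α * ‖s‖ ^ 2) := by ring
      _ ≤ α * (‖S‖ ^ 2 * r / 4) * (α * ‖s‖ ^ 2) := by gcongr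
  have e3 : ‖((α ^ 2 * ⟪T s, V (T s)⟫ / 2 : ℝ) : ℂ)‖ ≤ α * (M / 2) * (α * ‖s‖ ^ 2) := by
    rw [Complex.norm_real, Real.norm_of_nonneg (by positivity)]
    calc α ^ 2 * ⟪T s, V (T s)⟫ / 2 ≤ α ^ 2 * (M * ‖s‖ ^ 2) / 2 := by gcongr
      _ = α * (M / 2) * (α * ‖s‖ ^ 2) := by ring
  have hsplit : charFun μ (√α • s) - Complex.exp (-(x : ℝ)) =
      (charFun μ (√α • s) - 1 + ((α * ⟪s, S s⟫ : ℝ) : ℂ) / 2) -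
        ((Real.exp (-x) - 1 - (-x) : ℝ) : ℂ) - ((α ^ 2 * ⟪T s, V (T s)⟫ / 2 : ℝ) : ℂ) := by
    have : (x : ℂ) = α * ⟪s, S s⟫ / 2 - α ^ 2 * ⟪T s, V (T s)⟫ / 2 := by
      rw [hxe]; push_cast; ring
    push_cast
    rw [this]
    ring
  rw [hsplit]
  refine (norm_sub_le _ _).trans ((add_le_add ((norm_sub_le _ _).trans (add_le_add e1 e2))
    e3).trans ?_)
  rw [← add_mul, ← add_mul]
  refine mul_le_mul_of_nonneg_right ?_ (by positivity)
  have h1 : α * (‖S‖ ^ 2 * r / 4) + α * (M / 2) ≤ α * K := by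
    rw [← mul_add]
    gcongr
    have : 0 ≤ ‖S‖ * r / 2 + 1 := by positivity
    simp only [K]; linarith
  linarith

/-- **Gaussian limit of the stationary characteristic functions.** Iterating the fixed point
equation `ψ t = ψ ((1 + α T) t) * charFun μ (√α t)` and its Gaussian analogue along the orbit of `t`
telescopes the difference of the two, and the Lyapunov function bounds the sum of the one-step
errors uniformly in `α`. -/
theorem exists_norm_fixedPoint_sub_gaussian_le (hμ : MemLp id 2 μ) (h0 : ∫ y, y ∂μ = 0)
    (hcov : ∀ u, ∫ y, ⟪y, u⟫ ^ 2 ∂μ = ⟪u, S u⟫) (hm : 0 < m) (hV : ∀ t, m * ‖t‖ ^ 2 ≤ ⟪t, V t⟫)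
    (hL : ∀ t, ⟪T t, V t⟫ + ⟪t, V (T t)⟫ = -⟪t, S t⟫) (hc : 0 < c)
    (hdec : ∀ α ∈ Set.Ioo 0 a, ∀ t,
      ⟪(1 + α • T) t, V ((1 + α • T) t)⟫ + α * c * ‖t‖ ^ 2 ≤ ⟪t, V t⟫)
    (t : E) {ε : ℝ} (hε : 0 < ε) :
    ∃ δ : ℝ, 0 < δ ∧ ∀ α ∈ Set.Ioo 0 a, α < δ → ∀ ψ : E → ℂ, Continuous ψ → ψ 0 = 1 →
      (∀ s, ‖ψ s‖ ≤ 1) → (∀ s, ψ s = ψ ((1 + α • T) s) * charFun μ (√α • s)) →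
      ‖ψ t - Complex.exp (-(⟪t, V t⟫ / 2 : ℝ))‖ ≤ ε := by
  have hVt : 0 ≤ ⟪t, V t⟫ := le_trans (by positivity) (hV t)
  obtain ⟨δ, hδ, hstep⟩ := exists_norm_charFun_sub_exp_le hμ h0 hcov hm hV hL hc hdec
    (⟪t, V t⟫ / m) (ε := ε * c / (⟪t, V t⟫ + 1)) (by positivity)
  refine ⟨δ, hδ, fun α hα hαδ ψ hψ hψ0 hψ1 hfix => ?_⟩
  have hα0 := hα.1
  have hR := hdec α hα
  have hstep := hstep α hα hαδ
  set R : E →L[ℝ] E := 1 + α • T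
  let g : E → ℂ := fun s => Complex.exp (-(⟪s, V s⟫ / 2 : ℝ))
  let h : E → ℂ := fun s => Complex.exp (-((⟪s, V s⟫ - ⟪R s, V (R s)⟫) / 2 : ℝ))
  have hg : ∀ s, g s = g (R s) * h s := by
    intro s
    simp only [g, h]
    rw [← Complex.exp_add]
    congr 1
    push_cast
    ring
  have hh : ∀ s, ‖h s‖ ≤ 1 := by
    intro s
    simp only [h]
    rw [← Complex.ofReal_neg, Complex.norm_exp_ofReal, Real.exp_le_one_iff]
    have h1 := hR s
    have h2 : 0 ≤ α * c * ‖s‖ ^ 2 := by positivity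
    linarith
  have hone : ∀ s, ‖ψ s - g s‖ ≤ ‖ψ (R s) - g (R s)‖ + ‖charFun μ (√α • s) - h s‖ := by
    intro s
    have : ψ s - g s = (ψ (R s) - g (R s)) * h s + ψ (R s) * (charFun μ (√α • s) - h s) := by
      rw [hfix s, hg s]; ring
    rw [this]
    refine (norm_add_le _ _).trans (add_le_add ?_ ?_)
    · rw [norm_mul]
      exact mul_le_of_le_one_right (norm_nonneg _) (hh s)
    · rw [norm_mul]
      exact mul_le_of_le_one_left (norm_nonneg _) (hψ1 _)
  have htel : ∀ n : ℕ, ‖ψ t - g t‖ ≤ ‖ψ ((R ^ n) t) - g ((R ^ n) t)‖ +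
      ∑ j ∈ Finset.range n, ‖charFun μ (√α • (R ^ j) t) - h ((R ^ j) t)‖ := by
    intro n
    induction n with
    | zero => simp
    | succ n ih =>
      rw [Finset.sum_range_succ, pow_succ' R, mul_apply_eq_comp]
      linarith [hone ((R ^ n) t)]
  have hsum : ∀ n : ℕ,
      ∑ j ∈ Finset.range n, ‖charFun μ (√α • (R ^ j) t) - h ((R ^ j) t)‖ ≤ ε := by
    intro n
    calc ∑ j ∈ Finset.range n, ‖charFun μ (√α • (R ^ j) t) - h ((R ^ j) t)‖
        ≤ ∑ j ∈ Finset.range n, ε / (⟪t, V t⟫ + 1) * (α * c * ‖(R ^ j) t‖ ^ 2) := by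
          refine Finset.sum_le_sum fun j _ =>
            (hstep _ (norm_sq_pow_apply_le hV hm (by positivity) hR j t)).trans_eq ?_
          ring
      _ = ε / (⟪t, V t⟫ + 1) * ∑ j ∈ Finset.range n, α * c * ‖(R ^ j) t‖ ^ 2 := by
          rw [Finset.mul_sum]
      _ ≤ ε / (⟪t, V t⟫ + 1) * ⟪t, V t⟫ := by
          gcongr
          exact sum_norm_sq_pow_apply_le hV hm hR n t
      _ ≤ ε := by
          rw [div_mul_eq_mul_div, div_le_iff₀ (by positivity)]
          gcongr
          linarith
  have hRt : Tendsto (fun n : ℕ => (R ^ n) t) atTop (𝓝 0) := by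
    have hz := (summable_norm_pow_of_lyapunov_decrease hV hm
      (by positivity : 0 < α * c) hR).tendsto_atTop_zero
    refine squeeze_zero_norm (fun n => (R ^ n).le_opNorm t) ?_
    simpa using hz.mul_const ‖t‖
  have hgc : Continuous g := by fun_prop
  have hlim : Tendsto (fun n : ℕ => ‖ψ ((R ^ n) t) - g ((R ^ n) t)‖) atTop (𝓝 0) := by
    have h1 := (((hψ.sub hgc).norm).tendsto 0).comp hRt
    have h2 : ‖ψ 0 - g 0‖ = 0 := by simp [hψ0, g]
    rw [Pi.sub_apply, h2] at h1
    exact h1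
  have hlim' := hlim.add_const ε
  rw [zero_add] at hlim'
  exact ge_of_tendsto' hlim' fun n => (htel n).trans (by gcongr; exact hsum n)

end GaussianLimit

/-! ### Affine random recursions with contracting linear part -/

section Perpetuity

open scoped RealInnerProductSpace ENNReal
open Complex (I)

lemma adjoint_smul_pow {E : Type*} [NormedAddCommGroup E] [InnerProductSpace ℝ E]
    [CompleteSpace E] (B : E →L[ℝ] E) (β : ℝ) (n : ℕ) (t : E) :
    (β • B ^ n).adjoint t = β • ((B.adjoint) ^ n) t := by
  rw [← ContinuousLinearMap.star_eq_adjoint, ← ContinuousLinearMap.star_eq_adjoint, star_smul,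
    star_pow, star_trivial]
  rfl

variable {E : Type*} [NormedAddCommGroup E] [InnerProductSpace ℝ E] [FiniteDimensional ℝ E]
  [MeasurableSpace E] [BorelSpace E] {Ω : Type*} [MeasurableSpace Ω] {P : Measure Ω}
  {w : ℕ → Ω → E} {B : E →L[ℝ] E} {β : ℝ}

lemma charFun_map_clm_comp {X : Ω → E} (hX : AEMeasurable X P) (L : E →L[ℝ] E) (t : E) :
    charFun (P.map fun ω => L (X ω)) t = charFun (P.map X) (L.adjoint t) := by
  rw [charFun_apply, charFun_apply, integral_map (by fun_prop) (by fun_prop),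
    integral_map hX (by fun_prop)]
  simp_rw [ContinuousLinearMap.adjoint_inner_right]

/-- The law of `∑ B ^ (k j) (β w j)` depends on the exponents `k j` only up to
their order. -/
lemma charFun_map_sum_pow_apply [IsProbabilityMeasure P] (hind : iIndepFun w P)
    (hid : ∀ j, IdentDistrib (w j) (w 0) P P) (k : ℕ → ℕ) (n : ℕ) (t : E) :
    charFun (P.map fun ω => ∑ j ∈ Finset.range n, (β • B ^ k j) (w j ω)) t =
      ∏ j ∈ Finset.range n, charFun (P.map (w 0)) (β • ((B.adjoint) ^ k j) t) := by
  have hm : ∀ j, AEMeasurable (w j) P := fun j => (hid j).aemeasurable_fst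
  have hind' : iIndepFun (fun j ω => (β • B ^ k j) (w j ω)) P :=
    hind.comp (fun j => ⇑(β • B ^ k j)) fun j => (β • B ^ k j).continuous.measurable
  rw [iIndepFun.charFun_map_fun_finsetSum_eq_prod (X := fun j ω => (β • B ^ k j) (w j ω))
    (fun j _ => by have := hm j; fun_prop) (hind'.restrict _), Finset.prod_apply]
  refine Finset.prod_congr rfl fun j _ => ?_
  rw [charFun_map_clm_comp (hm j), adjoint_smul_pow, (hid j).map_eq]

/-- The series `∑ B ^ j (β w j)` converges in `L²` as soon as the powers of `B` are summable. -/
lemma exists_tendstoInMeasure_sum_pow_apply [IsProbabilityMeasure P]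
    (hid : ∀ j, IdentDistrib (w j) (w 0) P P) (hsq : MemLp (w 0) 2 P)
    (hB : Summable fun n : ℕ => ‖B ^ n‖) (β : ℝ) :
    ∃ Z : Ω → E, MemLp Z 2 P ∧ TendstoInMeasure P
      (fun n ω => ∑ j ∈ Finset.range n, (β • B ^ j) (w j ω)) atTop Z := by
  have hw : ∀ j, MemLp (w j) 2 P := fun j => (hid j).symm.memLp_snd hsq
  have hf : ∀ j, MemLp (fun ω => (β • B ^ j) (w j ω)) 2 P := fun j =>
    (β • B ^ j).comp_memLp' (hw j)
  let f : ℕ → Lp E 2 P := fun j => (hf j).toLp _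
  have hle : ∀ j, ‖f j‖ ≤ ‖B ^ j‖ * (|β| * ‖hsq.toLp‖) := by
    intro j
    have h1 : ‖f j‖ ≤ ‖β • B ^ j‖ * ‖(hw j).toLp‖ := by
      have : f j = (β • B ^ j).compLp ((hw j).toLp) := by
        ext1
        filter_upwards [(hf j).coeFn_toLp, (β • B ^ j).coeFn_compLp ((hw j).toLp),
          (hw j).coeFn_toLp] with ω h1 h2 h3
        rw [h1, h2, h3]
      rw [this]
      exact (β • B ^ j).norm_compLp_le _
    have h2 : ‖(hw j).toLp‖ = ‖hsq.toLp‖ := by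
      rw [Lp.norm_toLp, Lp.norm_toLp, (hid j).eLpNorm_eq]
    rw [h2, norm_smul, Real.norm_eq_abs] at h1
    linarith
  have hs : Summable f := Summable.of_norm_bounded (hB.mul_right _) hle
  obtain ⟨z, hz⟩ := hs
  refine ⟨z, Lp.memLp z, ?_⟩
  have := tendstoInMeasure_of_tendsto_Lp hz.tendsto_sum_nat
  refine this.congr_left fun n => ?_
  have hall : ∀ᵐ ω ∂P, ∀ j, f j ω = (β • B ^ j) (w j ω) :=
    ae_all_iff.2 fun j => (hf j).coeFn_toLp
  filter_upwards [Lp.coeFn_finsetSum (Finset.range n) f, hall] with ω h1 h2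
  rw [h1, Finset.sum_apply]
  exact Finset.sum_congr rfl fun j _ => h2 j

/-- The characteristic function of the law of `B Y + β w` for independent `Y` and `w`. -/
lemma charFun_map_prod_affine {ρ μ : Measure E} [SFinite ρ] [SFinite μ] (B : E →L[ℝ] E) (β : ℝ)
    (t : E) : charFun ((ρ.prod μ).map fun p => B p.1 + β • p.2) t =
      charFun ρ (B.adjoint t) * charFun μ (β • t) := by
  rw [charFun_apply, charFun_apply, charFun_apply, integral_map (by fun_prop) (by fun_prop),
    ← integral_prod_mul]
  congr 1 with p
  rw [ContinuousLinearMap.adjoint_inner_right, inner_add_left, real_inner_smul_left,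
    real_inner_smul_right, Complex.ofReal_add, add_mul, Complex.exp_add]

variable [IsProbabilityMeasure P] {Z : Ω → E}

lemma tendsto_prod_charFun_of_tendstoInMeasure (hind : iIndepFun w P)
    (hid : ∀ j, IdentDistrib (w j) (w 0) P P)
    (hZ : TendstoInMeasure P (fun n ω => ∑ j ∈ Finset.range n, (β • B ^ j) (w j ω)) atTop Z)
    (t : E) :
    Tendsto (fun n => ∏ j ∈ Finset.range n, charFun (P.map (w 0)) (β • ((B.adjoint) ^ j) t)) atTop
      (𝓝 (charFun (P.map Z) t)) := by
  have hm : ∀ j, AEMeasurable (w j) P := fun j => (hid j).aemeasurable_fst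
  have h := ProbabilityMeasure.tendsto_iff_tendsto_charFun.1
    (hZ.tendstoInDistribution fun n => by fun_prop).tendsto t
  refine h.congr fun n => ?_
  exact charFun_map_sum_pow_apply hind hid (fun j => j) n t

lemma charFun_map_series_fixedPoint (hind : iIndepFun w P)
    (hid : ∀ j, IdentDistrib (w j) (w 0) P P)
    (hZ : TendstoInMeasure P (fun n ω => ∑ j ∈ Finset.range n, (β • B ^ j) (w j ω)) atTop Z)
    (t : E) :
    charFun (P.map Z) t = charFun (P.map Z) (B.adjoint t) * charFun (P.map (w 0)) (β • t) := by
  have h1 := (tendsto_prod_charFun_of_tendstoInMeasure hind hid hZ t).comp (tendsto_add_atTop_nat 1)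
  have h2 := (tendsto_prod_charFun_of_tendstoInMeasure hind hid hZ (B.adjoint t)).mul_const
    (charFun (P.map (w 0)) (β • t))
  refine tendsto_nhds_unique h1 (h2.congr fun n => ?_)
  rw [Function.comp_apply, Finset.prod_range_succ']
  simp [pow_succ]

/-- The forward iterates of `Y ↦ B Y + β w` converge in distribution to the sum of the series
`∑ B ^ j (β w j)`: reversing the order of the noise does not change the law, and the contribution of
the initial value dies out. The initial value may depend on the noise. -/
lemma tendstoInDistribution_affine_iterates (hind : iIndepFun w P)
    (hid : ∀ j, IdentDistrib (w j) (w 0) P P) (hB : Summable fun n : ℕ => ‖B ^ n‖)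
    (hZ : TendstoInMeasure P (fun n ω => ∑ j ∈ Finset.range n, (β • B ^ j) (w j ω)) atTop Z)
    {Y : ℕ → Ω → E} (hY0 : AEMeasurable (Y 0) P)
    (hY : ∀ n ω, Y (n + 1) ω = B (Y n ω) + β • w n ω) :
    TendstoInDistribution Y atTop Z (fun _ => P) P := by
  have hm : ∀ j, AEMeasurable (w j) P := fun j => (hid j).aemeasurable_fst
  let U : ℕ → Ω → E := fun n ω => ∑ j ∈ Finset.range n, (β • B ^ (n - 1 - j)) (w j ω)
  have hUm : ∀ n, AEMeasurable (U n) P := fun n => by fun_prop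
  have hYU : ∀ n ω, Y n ω = U n ω + (B ^ n) (Y 0 ω) := by
    intro n ω
    induction n with
    | zero => simp [U]
    | succ n ih =>
      have hU : U (n + 1) ω = B (U n ω) + β • w n ω := by
        simp only [U]
        rw [Finset.sum_range_succ, map_sum]
        congr 1
        · refine Finset.sum_congr rfl fun j hj => ?_
          have : n + 1 - 1 - j = (n - 1 - j) + 1 := by
            have := Finset.mem_range.1 hj
            omega
          rw [this, pow_succ' B]
          simp
        · simp
      rw [hY, ih, hU, map_add, pow_succ' B, mul_apply_eq_comp]
      abel
  have hYm : ∀ n, AEMeasurable (Y n) P := fun n => by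
    have : Y n = fun ω => U n ω + (B ^ n) (Y 0 ω) := funext (hYU n)
    rw [this]
    exact (hUm n).add ((B ^ n).continuous.measurable.comp_aemeasurable hY0)
  -- `U n` is the partial sum of the series with its noise terms in reversed order.
  have hUZ : TendstoInDistribution U atTop Z (fun _ => P) P := by
    have hd := hZ.tendstoInDistribution fun n => by fun_prop
    refine ⟨hUm, hd.aemeasurable_limit, hd.tendsto.congr fun n => Subtype.ext ?_⟩
    have := Measure.isProbabilityMeasure_map (hUm n)
    have := Measure.isProbabilityMeasure_map (hd.forall_aemeasurable n)
    refine Measure.ext_of_charFun (funext fun t => ?_)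
    refine (charFun_map_sum_pow_apply hind hid (fun j => j) n t).trans
      (Eq.trans ?_ (charFun_map_sum_pow_apply hind hid (fun j => n - 1 - j) n t).symm)
    exact (Finset.prod_range_reflect
      (fun j => charFun (P.map (w 0)) (β • ((B.adjoint) ^ j) t)) n).symm
  refine tendstoInDistribution_of_tendstoInMeasure_sub Y Z hUZ ?_ hYm
  refine tendstoInMeasure_of_tendsto_ae
    (fun n => ((hYm n).sub (hUm n)).aestronglyMeasurable) (Eventually.of_forall fun ω => ?_)
  have h0 : ∀ n, (Y - U) n ω = (B ^ n) (Y 0 ω) := fun n => by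
    simp [hYU n ω]
  simp only [h0]
  refine squeeze_zero_norm (fun n => (B ^ n).le_opNorm _) ?_
  simpa using hB.tendsto_atTop_zero.mul_const ‖Y 0 ω‖

end Perpetuity

/-! ### Linear stochastic approximation in coordinates -/

section Assembly

open scoped RealInnerProductSpace
open Complex (I)

variable {d : ℕ}

lemma matVec_eq_toEuclideanCLM (M : Matrix (Fin d) (Fin d) ℝ) (x : EuclideanSpace ℝ (Fin d)) :
    matVec M x = toEuclideanCLM (𝕜 := ℝ) M x := rfl

lemma inner_matVec (M : Matrix (Fin d) (Fin d) ℝ) (x y : EuclideanSpace ℝ (Fin d)) :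
    ⟪x, matVec M y⟫ = ⟪(toEuclideanCLM (𝕜 := ℝ) M).adjoint x, y⟫ := by
  rw [ContinuousLinearMap.adjoint_inner_left, matVec_eq_toEuclideanCLM]

lemma Matrix.PosDef.inner_toEuclideanCLM_pos {M : Matrix (Fin d) (Fin d) ℝ} (hM : M.PosDef)
    (t : EuclideanSpace ℝ (Fin d)) (ht : t ≠ 0) : 0 < ⟪t, toEuclideanCLM (𝕜 := ℝ) M t⟫ := by
  rw [inner_toEuclideanCLM]
  have h0 : t.ofLp ≠ 0 := fun h => ht (by ext i; simp [h])
  simpa using hM.dotProduct_mulVec_pos h0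

lemma Matrix.PosDef.inner_toEuclideanCLM_symm {M : Matrix (Fin d) (Fin d) ℝ} (hM : M.PosDef)
    (x y : EuclideanSpace ℝ (Fin d)) :
    ⟪x, toEuclideanCLM (𝕜 := ℝ) M y⟫ = ⟪toEuclideanCLM (𝕜 := ℝ) M x, y⟫ := by
  have h : (toEuclideanCLM (𝕜 := ℝ) M).adjoint = toEuclideanCLM (𝕜 := ℝ) M := by
    rw [← ContinuousLinearMap.star_eq_adjoint, ← map_star]
    exact congrArg _ hM.isHermitian
  rw [← matVec_eq_toEuclideanCLM, inner_matVec, h]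

lemma inner_adjoint_add_inner_adjoint_of_lyapunov {A V S : Matrix (Fin d) (Fin d) ℝ}
    (h : A * V + V * Aᵀ + S = 0) (t : EuclideanSpace ℝ (Fin d)) :
    ⟪(toEuclideanCLM (𝕜 := ℝ) A).adjoint t, toEuclideanCLM (𝕜 := ℝ) V t⟫ +
      ⟪t, toEuclideanCLM (𝕜 := ℝ) V ((toEuclideanCLM (𝕜 := ℝ) A).adjoint t)⟫ =
      -⟪t, toEuclideanCLM (𝕜 := ℝ) S t⟫ := by
  have hadj : (toEuclideanCLM (𝕜 := ℝ) A).adjoint = toEuclideanCLM (𝕜 := ℝ) Aᵀ := by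
    rw [← ContinuousLinearMap.star_eq_adjoint, ← map_star, Matrix.star_eq_conjTranspose,
      Matrix.conjTranspose_eq_transpose_of_trivial]
  have h1 := congrArg (fun M => ⟪t, toEuclideanCLM (𝕜 := ℝ) M t⟫) h
  simp only [map_add, map_mul, map_zero, _root_.add_apply, mul_apply_eq_comp, inner_add_right,
    _root_.zero_apply, inner_zero_right] at h1
  rw [ContinuousLinearMap.adjoint_inner_left, hadj]
  linarith

/-- The second moments of a centered random vector with covariance matrix `S`. -/
lemma integral_inner_sq_map_eq {S : Matrix (Fin d) (Fin d) ℝ} {Ω : Type*} [MeasurableSpace Ω]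
    {P : Measure Ω} [IsProbabilityMeasure P] {X : Ω → EuclideanSpace ℝ (Fin d)}
    (hX : MemLp X 2 P) (h0 : ∫ ω, X ω ∂P = 0)
    (hcov : ∀ i j, cov[fun ω => X ω i, fun ω => X ω j; P] = S i j)
    (u : EuclideanSpace ℝ (Fin d)) :
    ∫ y, ⟪y, u⟫ ^ 2 ∂(P.map X) = ⟪u, toEuclideanCLM (𝕜 := ℝ) S u⟫ := by
  have hXm := hX.aemeasurable
  have := Measure.isProbabilityMeasure_map hXm
  have hid : MemLp id 2 (P.map X) :=
    (memLp_map_measure_iff aestronglyMeasurable_id hXm).2 hX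
  have hmean : ∫ y, id y ∂(P.map X) = 0 := by
    rw [integral_map hXm aestronglyMeasurable_id]
    exact h0
  have h1 := covarianceBilin_apply hid u u
  have h2 := covarianceBilin_apply_pi (X := fun i ω => X ω i) (μ := P)
    (fun i => by
      have := (EuclideanSpace.proj (𝕜 := ℝ) i : EuclideanSpace ℝ (Fin d) →L[ℝ] ℝ).comp_memLp' hX
      exact this) u u
  have h3 : ∫ y, ⟪y, u⟫ ^ 2 ∂(P.map X) = covarianceBilin (P.map X) u u := by
    rw [h1, hmean]
    simp only [sub_zero, sq, real_inner_comm u]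
  rw [h3]
  refine h2.trans ?_
  simp only [hcov]
  rw [inner_toEuclideanCLM]
  simp only [dotProduct, mulVec, Finset.mul_sum]
  exact Finset.sum_congr rfl fun i _ => Finset.sum_congr rfl fun j _ => by ring

/-- The centered Gaussian law whose covariance solves the Lyapunov equation solves the limit
equation. -/
lemma solvesLimitEq_multivariateGaussian {A S V : Matrix (Fin d) (Fin d) ℝ} (hV : V.PosDef)
    (h : A * V + V * Aᵀ + S = 0) : SolvesLimitEq A S (multivariateGaussian 0 V) := by
  intro t
  set ν := multivariateGaussian (0 : EuclideanSpace ℝ (Fin d)) V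
  have hν : MemLp id 2 ν := IsGaussian.memLp_two_id
  have hchar : ∀ s, charFun ν s =
      Complex.exp (-(⟪s, toEuclideanCLM (𝕜 := ℝ) V s⟫ / 2 : ℝ)) := by
    intro s
    rw [charFun_multivariateGaussian hV.posSemidef, inner_toEuclideanCLM, inner_zero_right]
    congr 1
    push_cast
    ring
  set v := (toEuclideanCLM (𝕜 := ℝ) A).adjoint t
  have hgrad := integral_inner_mul_exp_of_charFun_eq hν hV.inner_toEuclideanCLM_symm hchar t v
  have i1 : Integrable (fun y : EuclideanSpace ℝ (Fin d) => Complex.exp (⟪y, t⟫ * I)) ν :=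
    (integrable_const (1 : ℝ)).mono' (by fun_prop)
      (Eventually.of_forall fun y => by simp [Complex.norm_exp_ofReal_mul_I])
  have i2 : Integrable (fun y : EuclideanSpace ℝ (Fin d) =>
      (⟪y, v⟫ : ℂ) * Complex.exp (⟪y, t⟫ * I)) ν := by
    have hi : Integrable (fun y : EuclideanSpace ℝ (Fin d) => ⟪y, v⟫) ν :=
      (hν.integrable (by norm_num)).inner_const v
    refine hi.norm.mono' (by fun_prop) (Eventually.of_forall fun y => ?_)
    rw [norm_mul, Complex.norm_exp_ofReal_mul_I, mul_one, Complex.norm_real]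
  have hform : (fun y : EuclideanSpace ℝ (Fin d) =>
      (((⟪t, matVec S t⟫ : ℝ) : ℂ) - 2 * I * ((⟪t, matVec A y⟫ : ℝ) : ℂ)) *
        Complex.exp (I * ((⟪t, y⟫ : ℝ) : ℂ))) = fun y =>
      ((⟪t, matVec S t⟫ : ℝ) : ℂ) * Complex.exp (⟪y, t⟫ * I) -
        2 * I * ((⟪y, v⟫ : ℂ) * Complex.exp (⟪y, t⟫ * I)) := by
    funext y
    rw [inner_matVec A, real_inner_comm y t, real_inner_comm y, mul_comm I]
    ring
  rw [hform]
  refine ⟨(i1.const_mul _).sub (i2.const_mul _), ?_⟩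
  rw [integral_sub (i1.const_mul _) (i2.const_mul _), integral_const_mul, integral_const_mul,
    hgrad, ← charFun_apply]
  have hL := inner_adjoint_add_inner_adjoint_of_lyapunov h t
  rw [hV.inner_toEuclideanCLM_symm t, real_inner_comm _ (toEuclideanCLM (𝕜 := ℝ) V t)] at hL
  have hS : ⟪t, matVec S t⟫ = -2 * ⟪v, toEuclideanCLM (𝕜 := ℝ) V t⟫ := by
    rw [matVec_eq_toEuclideanCLM]
    linarith
  rw [hS]
  push_cast
  linear_combination (-2 * (⟪v, toEuclideanCLM (𝕜 := ℝ) V t⟫ : ℂ) * charFun ν t) * Complex.I_sq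

/-- The centered scaled iterates follow `Y ↦ (1 + α A) Y + √α w`. -/
lemma scaledSA_succ {Ω : Type*} {A : Matrix (Fin d) (Fin d) ℝ} {b xs : EuclideanSpace ℝ (Fin d)}
    (hxs : matVec A xs + b = 0) (w : ℕ → Ω → EuclideanSpace ℝ (Fin d)) {α : ℝ} (hα : 0 < α)
    (X₀ : Ω → EuclideanSpace ℝ (Fin d)) (k : ℕ) (ω : Ω) :
    scaledSA A b xs w α X₀ (k + 1) ω =
      (1 + α • toEuclideanCLM (𝕜 := ℝ) A) (scaledSA A b xs w α X₀ k ω) + √α • w k ω := by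
  have hb : b = -(toEuclideanCLM (𝕜 := ℝ) A xs) := eq_neg_of_add_eq_zero_right hxs
  have hsq : (√α)⁻¹ * α = √α := by
    rw [inv_mul_eq_iff_eq_mul₀ (Real.sqrt_pos.2 hα).ne', Real.mul_self_sqrt hα.le]
  simp only [scaledSA, linearSA, matVec_eq_toEuclideanCLM]
  rw [hb, _root_.add_apply, one_apply_eq_self, _root_.smul_apply, map_smul, map_sub]
  generalize linearSA A _ w α X₀ k ω = x
  have hw : √α • w k ω = (√α)⁻¹ • α • w k ω := by rw [smul_smul, hsq]
  rw [hw]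
  module

lemma isStationaryLaw_of_charFun {A : Matrix (Fin d) (Fin d) ℝ} {α : ℝ}
    {μ ρ : Measure (EuclideanSpace ℝ (Fin d))} [IsProbabilityMeasure μ] [IsProbabilityMeasure ρ]
    (h : ∀ t, charFun ρ t =
      charFun ρ ((1 + α • toEuclideanCLM (𝕜 := ℝ) A).adjoint t) * charFun μ (√α • t)) :
    IsStationaryLaw A α μ ρ := by
  have hB : (fun p : EuclideanSpace ℝ (Fin d) × EuclideanSpace ℝ (Fin d) =>
      p.1 + α • matVec A p.1 + √α • p.2) =
      fun p => (1 + α • toEuclideanCLM (𝕜 := ℝ) A) p.1 + √α • p.2 := rfl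
  rw [IsStationaryLaw, hB]
  have : IsProbabilityMeasure ((ρ.prod μ).map
      fun p => (1 + α • toEuclideanCLM (𝕜 := ℝ) A) p.1 + √α • p.2) :=
    Measure.isProbabilityMeasure_map (by fun_prop)
  refine Measure.ext_of_charFun (funext fun t => ?_)
  rw [charFun_map_prod_affine, h t]

end Assembly

theorem theorem2 {d : ℕ} (A S : Matrix (Fin d) (Fin d) ℝ) (hA : IsHurwitz A) (hS : S.PosDef)
    (b xs : EuclideanSpace ℝ (Fin d)) (hxs : matVec A xs + b = 0)
    {Ω : Type*} [MeasurableSpace Ω] (P : Measure Ω) [IsProbabilityMeasure P]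
    (w : ℕ → Ω → EuclideanSpace ℝ (Fin d))
    (hw_indep : iIndepFun w P)
    (hw_ident : ∀ k, IdentDistrib (w k) (w 0) P P)
    (hw_sq : MemLp (w 0) 2 P)
    (hw_mean : ∫ ω, w 0 ω ∂P = 0)
    (hw_cov : ∀ i j, cov[fun ω => w 0 ω i, fun ω => w 0 ω j; P] = S i j) :
    ∃ αbar : ℝ, 0 < αbar ∧
      ∃ π : ℝ → ProbabilityMeasure (EuclideanSpace ℝ (Fin d)),
        -- part (1)
        (∀ α ∈ Set.Ioo 0 αbar,
          (∀ X₀ : Ω → EuclideanSpace ℝ (Fin d), AEMeasurable X₀ P →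
            TendstoInDistribution (fun k => scaledSA A b xs w α X₀ k) atTop
              (id : EuclideanSpace ℝ (Fin d) → EuclideanSpace ℝ (Fin d))
              (fun _ => P) (π α : Measure (EuclideanSpace ℝ (Fin d)))) ∧
          IsStationaryLaw A α (P.map (w 0)) (π α : Measure (EuclideanSpace ℝ (Fin d))) ∧
          Integrable (fun y => ‖y‖ ^ 2) (π α : Measure (EuclideanSpace ℝ (Fin d)))) ∧
        -- part (2)
        ∃ ν : ProbabilityMeasure (EuclideanSpace ℝ (Fin d)),
          (∀ a : ℕ → ℝ, (∀ i, a i ∈ Set.Ioo 0 αbar) → Tendsto a atTop (𝓝 0) →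
            Tendsto (fun i => π (a i)) atTop (𝓝 ν)) ∧
          SolvesLimitEq A S (ν : Measure (EuclideanSpace ℝ (Fin d))) ∧
          ((∃! ρ : ProbabilityMeasure (EuclideanSpace ℝ (Fin d)),
              SolvesLimitEq A S (ρ : Measure (EuclideanSpace ℝ (Fin d)))) →
            ∃ SY : Matrix (Fin d) (Fin d) ℝ,
              (A * SY + SY * Aᵀ + S = 0 ∧
                ∀ V : Matrix (Fin d) (Fin d) ℝ, A * V + V * Aᵀ + S = 0 → V = SY) ∧
              SY.PosDef ∧
              (ν : Measure (EuclideanSpace ℝ (Fin d))) = multivariateGaussian 0 SY) := by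
  obtain ⟨V, hV, hVpos, hVuniq⟩ := hA.exists_lyapunov hS
  have hwm : AEMeasurable (w 0) P := hw_sq.aemeasurable
  set μ : Measure (EuclideanSpace ℝ (Fin d)) := P.map (w 0)
  have hμ : IsProbabilityMeasure μ := Measure.isProbabilityMeasure_map hwm
  have hμ2 : MemLp id 2 μ := (memLp_map_measure_iff aestronglyMeasurable_id hwm).2 hw_sq
  have hμ0 : ∫ y, y ∂μ = 0 := by
    rw [integral_map hwm (f := fun y => y) (by fun_prop)]
    exact hw_mean
  have hμcov := integral_inner_sq_map_eq hw_sq hw_mean hw_cov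
  have hL := inner_adjoint_add_inner_adjoint_of_lyapunov hV
  obtain ⟨m, hm, hVm⟩ := exists_mul_norm_sq_le_inner_self _ hVpos.inner_toEuclideanCLM_pos
  obtain ⟨a, ha, c, hc, hdec⟩ := exists_lyapunov_decrease hS.inner_toEuclideanCLM_pos hL
  have hadj : ∀ α : ℝ, (1 + α • toEuclideanCLM (𝕜 := ℝ) A).adjoint =
      1 + α • (toEuclideanCLM (𝕜 := ℝ) A).adjoint := fun α => by
    simp only [← ContinuousLinearMap.star_eq_adjoint, star_add, star_one, star_smul, star_trivial]
  have hsum : ∀ α ∈ Set.Ioo 0 a,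
      Summable fun n : ℕ => ‖(1 + α • toEuclideanCLM (𝕜 := ℝ) A) ^ n‖ := by
    intro α hα
    refine (summable_norm_pow_of_lyapunov_decrease hVm hm (mul_pos hα.1 hc)
      (hdec α hα)).congr fun n => ?_
    rw [← hadj, ← ContinuousLinearMap.star_eq_adjoint, ← star_pow,
      ContinuousLinearMap.star_eq_adjoint]
    exact LinearIsometryEquiv.norm_map _ _
  have hZ : ∀ α, ∃ Z : Ω → EuclideanSpace ℝ (Fin d), MemLp Z 2 P ∧ (α ∈ Set.Ioo 0 a →
      TendstoInMeasure P (fun n ω => ∑ j ∈ Finset.range n,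
        (√α • (1 + α • toEuclideanCLM (𝕜 := ℝ) A) ^ j) (w j ω)) atTop Z) := by
    intro α
    by_cases hα : α ∈ Set.Ioo 0 a
    · obtain ⟨Z, hZ2, hZ⟩ := exists_tendstoInMeasure_sum_pow_apply hw_ident hw_sq (hsum α hα) √α
      exact ⟨Z, hZ2, fun _ => hZ⟩
    · exact ⟨0, MemLp.zero, fun h => absurd h hα⟩
  choose Z hZ2 hZ using hZ
  -- Outside `(0, a)` the value of `π` is irrelevant.
  let π : ℝ → ProbabilityMeasure (EuclideanSpace ℝ (Fin d)) := fun α =>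
    ⟨P.map (Z α), Measure.isProbabilityMeasure_map (hZ2 α).aemeasurable⟩
  have hfix : ∀ α ∈ Set.Ioo 0 a, ∀ t, charFun (π α : Measure (EuclideanSpace ℝ (Fin d))) t =
      charFun (π α : Measure (EuclideanSpace ℝ (Fin d)))
        ((1 + α • toEuclideanCLM (𝕜 := ℝ) A).adjoint t) * charFun μ (√α • t) :=
    fun α hα t => charFun_map_series_fixedPoint hw_indep hw_ident (hZ α hα) t
  refine ⟨a, ha, π, fun α hα => ⟨fun X₀ hX₀ => ?_, isStationaryLaw_of_charFun (hfix α hα), ?_⟩,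
    ⟨multivariateGaussian 0 V, inferInstance⟩, fun u hu hu0 => ?_,
    solvesLimitEq_multivariateGaussian hVpos hV, fun _ => ⟨V, ⟨hV, hVuniq⟩, hVpos, rfl⟩⟩
  · have hY := tendstoInDistribution_affine_iterates hw_indep hw_ident (hsum α hα) (hZ α hα)
      (Y := scaledSA A b xs w α X₀) ((hX₀.sub_const xs).const_smul (√α)⁻¹)
      (scaledSA_succ hxs w hα.1 X₀)
    refine ⟨hY.forall_aemeasurable, aemeasurable_id, ?_⟩
    have hid : (⟨(π α : Measure (EuclideanSpace ℝ (Fin d))).map id,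
        Measure.isProbabilityMeasure_map aemeasurable_id⟩ :
          ProbabilityMeasure (EuclideanSpace ℝ (Fin d))) = π α := Subtype.ext Measure.map_id
    rw [hid]
    exact hY.tendsto
  · exact ((memLp_map_measure_iff aestronglyMeasurable_id (hZ2 α).aemeasurable).2
      (hZ2 α)).integrable_norm_pow (by norm_num)
  · refine ProbabilityMeasure.tendsto_of_tendsto_charFun fun t => ?_
    have hchar : charFun (multivariateGaussian 0 V) t =
        Complex.exp (-(inner ℝ t (toEuclideanCLM (𝕜 := ℝ) V t) / 2 : ℝ)) := by
      rw [charFun_multivariateGaussian hVpos.posSemidef, inner_toEuclideanCLM, inner_zero_right]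
      congr 1
      push_cast
      ring
    rw [ProbabilityMeasure.coe_mk, hchar, Metric.tendsto_nhds]
    intro ε hε
    obtain ⟨δ, hδ, hlim⟩ := exists_norm_fixedPoint_sub_gaussian_le hμ2 hμ0 hμcov hm hVm hL hc hdec t
      (half_pos hε)
    filter_upwards [hu0.eventually_lt_const hδ] with i hi
    rw [dist_eq_norm]
    refine (hlim (u i) (hu i) hi _ continuous_charFun (by simp) (fun s => norm_charFun_le_one s)
      fun s => ?_).trans_lt (half_lt_self hε)
    rw [← hadj]
    exact hfix (u i) (hu i) s
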